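/- Let $k$ be a field and let $A$ be a finite-dimensional, not necessarily associative or commutative, unital $k$-algebra with multiplicative identity $e$. Let $\varepsilon\colon A\to k$ be a counit, i.e., a $k$-linear map with $\varepsilon(e)=1$, and let $\tau$ be the bilinear form $\tau(a,a')=\varepsilon(aa')$ on $A$. Let $\mathrm{Aut}(A)$ denote the affine group scheme over $k$ with $\mathrm{Aut}(A)(R)=\mathrm{Aut}_{R\text{-alg}}(R\otimes_k A)$ for every commutative $k$-algebra $R$. Suppose that 1. there is a smooth connected subgroup scheme $G\subseteq \mathrm{Aut}(A)$ that stabilizes $\varepsilon$, i.e., $\varepsilon_R\circ g=\varepsilon_R$ for every commutative $k$-algebra $R$ and every $g\in G(R)$; 2. the trivial one-dimensional $G$-module $k$ is not a composition factor of the $G$-module $\ker\varepsilon$; and 3. the bilinear form $\tau$ is nondegenerate. Then $A$ is simple, i.e., $A\neq 0$ and the only two-sided ideals of $A$ are $0$ and $A$. -/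

import Mathlib

open scoped TensorProduct

universe u v

namespace NonAssocAut

variable {k : Type u} [Field k] {A : Type v} [NonAssocRing A] [Module k A]

section BaseChange

variable {R S T : Type u} [CommRing R] [Algebra k R] [CommRing S] [Algebra k S]
  [CommRing T] [Algebra k T]

/-- The base change along `φ : R → S` of an `R`-linear endomorphism of `R ⊗ A`: the `S`-linear
endomorphism of `S ⊗ A` that sends `1 ⊗ a` to the image of `f (1 ⊗ a)` under `φ ⊗ id`. -/
noncomputable def mapEnd (φ : R →ₐ[k] S) (f : (R ⊗[k] A) →ₗ[R] (R ⊗[k] A)) :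
    (S ⊗[k] A) →ₗ[S] (S ⊗[k] A) :=
  LinearMap.liftBaseChange S
    (φ.toLinearMap.rTensor A ∘ₗ f.restrictScalars k ∘ₗ TensorProduct.mk k R A 1)

theorem mapEnd_rTensor (φ : R →ₐ[k] S) (f : (R ⊗[k] A) →ₗ[R] (R ⊗[k] A)) (x : R ⊗[k] A) :
    mapEnd φ f (φ.toLinearMap.rTensor A x) = φ.toLinearMap.rTensor A (f x) := by
  have hsmul : ∀ (r : R) (y : R ⊗[k] A),
      φ.toLinearMap.rTensor A (r • y) = φ r • φ.toLinearMap.rTensor A y := by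
    intro r y
    induction y using TensorProduct.induction_on with
    | zero => simp
    | tmul s a => simp [TensorProduct.smul_tmul']
    | add y z hy hz => simp only [smul_add, map_add, hy, hz]
  induction x using TensorProduct.induction_on with
  | zero => simp
  | add y z hy hz => simp only [map_add, hy, hz]
  | tmul r a =>
    have h : r ⊗ₜ[k] a = r • ((1 : R) ⊗ₜ[k] a) := by simp [TensorProduct.smul_tmul']
    rw [h, hsmul, map_smul, map_smul, hsmul]
    simp [mapEnd]

theorem mapEnd_tmul (φ : R →ₐ[k] S) (f : (R ⊗[k] A) →ₗ[R] (R ⊗[k] A)) (s : S) (a : A) :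
    mapEnd φ f (s ⊗ₜ a) = s • φ.toLinearMap.rTensor A (f (1 ⊗ₜ a)) := by
  simp [mapEnd]

theorem mapEnd_id (φ : R →ₐ[k] S) :
    mapEnd φ (LinearMap.id : (R ⊗[k] A) →ₗ[R] (R ⊗[k] A)) = LinearMap.id := by
  ext a
  simp [mapEnd]

theorem mapEnd_comp (φ : R →ₐ[k] S) (f g : (R ⊗[k] A) →ₗ[R] (R ⊗[k] A)) :
    mapEnd φ (f ∘ₗ g) = mapEnd φ f ∘ₗ mapEnd φ g := by
  ext a
  simp [mapEnd_tmul, mapEnd_rTensor]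

/-- The map `GL(A)(R) → GL(A)(S)` induced by a homomorphism `φ : R → S` of `k`-algebras. -/
noncomputable def mapGL (φ : R →ₐ[k] S) (g : (R ⊗[k] A) ≃ₗ[R] (R ⊗[k] A)) :
    (S ⊗[k] A) ≃ₗ[S] (S ⊗[k] A) :=
  LinearEquiv.ofLinearMap (mapEnd φ g.toLinearMap) (mapEnd φ g.symm.toLinearMap)
    (by rw [← mapEnd_comp, g.comp_symm, mapEnd_id])
    (by rw [← mapEnd_comp, g.symm_comp, mapEnd_id])

end BaseChange

variable [IsScalarTower k A A] [SMulCommClass k A A]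

variable (k A) in
/-- `Aut(A)(R)`: the group of `R`-algebra automorphisms of the (non-associative) `R`-algebra
`R ⊗ A`, inside the group `GL(A)(R)` of its `R`-linear automorphisms. -/
def autPoints (R : Type u) [CommRing R] [Algebra k R] :
    Subgroup ((R ⊗[k] A) ≃ₗ[R] (R ⊗[k] A)) where
  carrier := {g | ∀ x y, g (x * y) = g x * g y}
  mul_mem' := by
    intro g h hg hh x y
    simp only [LinearEquiv.mul_apply]
    rw [hh, hg]
  one_mem' := fun _ _ => rfl
  inv_mem' := by
    intro g hg x y
    apply g.injective
    have hinv : ∀ z, g (g⁻¹ z) = z := fun z => g.apply_symm_apply z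
    rw [hg, hinv, hinv, hinv]

end NonAssocAut

open NonAssocAut

/-- A subgroup scheme `G` of the affine group scheme `Aut(A)` over the field `k`, through its
functor of points: a subgroup `G(R)` of `Aut(A)(R)` for every commutative `k`-algebra `R`,
functorial in `R`, and represented by a commutative `k`-algebra `k[G]` (that is, `G = Spec k[G]`),
with universal point `univ` in `G(k[G])`. -/
structure AutSubgroupScheme (k : Type u) [Field k] (A : Type v) [NonAssocRing A] [Module k A]
    [IsScalarTower k A A] [SMulCommClass k A A] where
  /-- The group `G(R)`. -/
  points : ∀ (R : Type u) [CommRing R] [Algebra k R], Subgroup ((R ⊗[k] A) ≃ₗ[R] (R ⊗[k] A))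
  points_le : ∀ (R : Type u) [CommRing R] [Algebra k R], points R ≤ autPoints k A R
  map_mem : ∀ {R S : Type u} [CommRing R] [Algebra k R] [CommRing S] [Algebra k S]
    (φ : R →ₐ[k] S) (g : (R ⊗[k] A) ≃ₗ[R] (R ⊗[k] A)), g ∈ points R → mapGL φ g ∈ points S
  /-- The coordinate ring `k[G]`. -/
  coordRing : Type u
  [commRing : CommRing coordRing]
  [algebra : Algebra k coordRing]
  /-- The universal point of `G`. -/
  univ : (coordRing ⊗[k] A) ≃ₗ[coordRing] (coordRing ⊗[k] A)
  univ_mem : univ ∈ points coordRing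
  existsUnique_map : ∀ (R : Type u) [CommRing R] [Algebra k R]
    (g : (R ⊗[k] A) ≃ₗ[R] (R ⊗[k] A)), g ∈ points R →
      ∃! φ : coordRing →ₐ[k] R, mapGL φ univ = g

namespace AutSubgroupScheme

attribute [instance] AutSubgroupScheme.commRing AutSubgroupScheme.algebra

variable {k : Type u} [Field k] {A : Type v} [NonAssocRing A] [Module k A]
  [IsScalarTower k A A] [SMulCommClass k A A]

/-- `G` is connected: the topological space of `G = Spec k[G]` is connected. -/
def IsConnected (G : AutSubgroupScheme k A) : Prop :=
  ConnectedSpace (PrimeSpectrum G.coordRing)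

/-- `G` is smooth over `k`. -/
def IsSmooth (G : AutSubgroupScheme k A) : Prop :=
  Algebra.Smooth k G.coordRing

/-- `G` stabilizes the linear form `ε`: `ε_R ∘ g = ε_R` for every `g` in `G(R)`. -/
def Stabilizes (G : AutSubgroupScheme k A) (ε : A →ₗ[k] k) : Prop :=
  ∀ (R : Type u) [CommRing R] [Algebra k R], ∀ g ∈ G.points R, ∀ x : R ⊗[k] A,
    ε.baseChange R (g x) = ε.baseChange R x

/-- The subspace `W` of `A` is a `G`-submodule: every `g` in `G(R)` maps `R ⊗ W` to itself. -/
def IsSubmodule (G : AutSubgroupScheme k A) (W : Submodule k A) : Prop :=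
  ∀ (R : Type u) [CommRing R] [Algebra k R], ∀ g ∈ G.points R, ∀ x ∈ W.baseChange R,
    g x ∈ W.baseChange R

/-- The trivial one-dimensional `G`-module `k` is a composition factor of the finite-dimensional
`G`-submodule `V` of `A`: there are `G`-submodules `W₂ ≤ W₁` of `V` such that `W₁ / W₂` is
one-dimensional with trivial action of `G`. -/
def HasTrivialCompositionFactor (G : AutSubgroupScheme k A) (V : Submodule k A) : Prop :=
  ∃ W₁ W₂ : Submodule k A, G.IsSubmodule W₁ ∧ G.IsSubmodule W₂ ∧ W₂ ≤ W₁ ∧ W₁ ≤ V ∧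
    Module.finrank k (W₁ ⧸ W₂.submoduleOf W₁) = 1 ∧
    ∀ (R : Type u) [CommRing R] [Algebra k R], ∀ g ∈ G.points R, ∀ x ∈ W₁.baseChange R,
      g x - x ∈ W₂.baseChange R

end AutSubgroupScheme

/-- The bilinear form `τ(a, a') = ε(a a')`. -/
def counitForm {k : Type u} [Field k] {A : Type v} [NonAssocRing A] [Module k A]
    [IsScalarTower k A A] [SMulCommClass k A A] (ε : A →ₗ[k] k) : LinearMap.BilinForm k A :=
  (LinearMap.mul k A).compr₂ ε

/-! The engine is `ideal_eq_bot`: a proper `G`-stable ideal `W` is zero. If `ε` vanishes on `W`,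
then `W` lies in the radical of `τ`. Otherwise pick `a` in `W` with `ε a = 1`; the class of `1 - a`
modulo `W ∩ ker ε` is nonzero and `G`-fixed, a trivial composition factor of `ker ε`.

It remains to make every ideal `G`-stable. Smoothness handles one ideal: the intersection of the
maximal ideals of `K ⊗ A`, with `K` the algebraic closure, is preserved by `G(K)`, and since `K ⊗
k[G]` is reduced, its trace on `A` is `G`-stable (`isSubmodule_geometricRadical`), hence zero. The
Jacobson radical of the multiplication algebra maps `A` into this trace, so that algebra is
semisimple and every ideal has a complementary ideal. Connectedness handles the rest: complementary
ideals are cut out by central idempotents, which a connected group must fix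
(`isSubmodule_of_isCompl`). -/

namespace NonAssocAut

/-! ### Smooth algebras are reduced; idempotents and rational points -/

theorem isIntegral_mul_of_isNilpotent {R W : Type*} [CommRing R] [CommRing W] [Algebra R W]
    {a : W} (ha : IsNilpotent a) (b : W) : IsIntegral R (a * b) := by
  obtain ⟨n, hn⟩ := (Commute.all a b).isNilpotent_mul_right ha
  refine IsIntegral.of_pow n.succ_pos ?_
  rw [pow_succ, hn, zero_mul]
  exact isIntegral_zero

/-- Integral closure commutes with smooth base change, and `K[X]` is integrally closed. For
nilpotent `f` the fraction `f / X` is integral, so it already lies in `K[X] ⊗ S`; hence `f` is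
divisible by `X`, and `X = 0` gives `f = 0`. -/
theorem isReduced_of_smooth (K S : Type*) [Field K] [CommRing S] [Algebra K S]
    [Algebra.Smooth K S] : IsReduced S := by
  open Polynomial in
  refine ⟨fun f hf => ?_⟩
  let F := FractionRing K[X]
  let T := K[X] ⊗[K] S
  have hX : (algebraMap K[X] F X) ≠ 0 := by simp
  let x : T ⊗[K[X]] F := ((1 : K[X]) ⊗ₜ[K] f : T) ⊗ₜ[K[X]] (algebraMap K[X] F X)⁻¹
  have hint : IsIntegral T x := by
    have h : x = (Algebra.TensorProduct.includeLeft : T →ₐ[T] T ⊗[K[X]] F)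
        ((Algebra.TensorProduct.includeRight : S →ₐ[K] T) f) *
        ((1 : T) ⊗ₜ[K[X]] (algebraMap K[X] F X)⁻¹) := by
      simp [x, T]
    have h1 : IsNilpotent ((Algebra.TensorProduct.includeRight : S →ₐ[K] T) f) := hf.map _
    have h2 := h1.map (Algebra.TensorProduct.includeLeft : T →ₐ[T] T ⊗[K[X]] F)
    rw [h]
    exact isIntegral_mul_of_isNilpotent (W := T ⊗[K[X]] F) h2 _
  obtain ⟨y, hy⟩ := (TensorProduct.toIntegralClosure_bijective_of_smooth (R := K[X]) (S := T)
    (B := F)).2 ⟨x, hint⟩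
  obtain ⟨s, hs⟩ : ∃ s : T, s ⊗ₜ[K[X]] (1 : F) = x := by
    have hy' : ((TensorProduct.toIntegralClosure K[X] T F y : integralClosure T (T ⊗[K[X]] F)) :
      T ⊗[K[X]] F) = x := by rw [hy]
    rw [← hy']
    clear hy hy'
    induction y using TensorProduct.induction_on with
    | zero => exact ⟨0, by simp⟩
    | add a b ha hb =>
      obtain ⟨s, hs⟩ := ha
      obtain ⟨t, ht⟩ := hb
      exact ⟨s + t, by simp [TensorProduct.add_tmul, hs, ht]⟩
    | tmul a b =>
      -- An integral element of `F` is a polynomial, which moves across the tensor sign.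
      obtain ⟨c, hc⟩ := IsIntegrallyClosed.isIntegral_iff.mp b.2
      refine ⟨c • a, ?_⟩
      rw [TensorProduct.smul_tmul, Algebra.smul_def, hc, mul_one]
      rfl
  have hinj : Function.Injective
      (Algebra.TensorProduct.includeLeft : T →ₐ[T] T ⊗[K[X]] F) :=
    Algebra.TensorProduct.includeLeft_injective (IsFractionRing.injective K[X] F)
  have key : (X : K[X]) • s = (1 : K[X]) ⊗ₜ[K] f := by
    apply hinj
    simp only [Algebra.TensorProduct.includeLeft_apply]
    have : ((X : K[X]) • s) ⊗ₜ[K[X]] (1 : F) = (X : K[X]) • x := by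
      rw [← hs, TensorProduct.smul_tmul']
    rw [this]
    simp only [x]
    rw [← TensorProduct.tmul_smul, Algebra.smul_def, mul_inv_cancel₀ hX]
  let ev : K[X] ⊗[K] S →ₐ[K] S := Algebra.TensorProduct.lift
    ((Algebra.ofId K S).comp (aeval (0 : K))) (AlgHom.id K S) (fun _ _ => Commute.all _ _)
  have h1 := congrArg ev key
  have h2 : (X : K[X]) • s = (X ⊗ₜ[K] (1 : S) : T) * s := by
    exact Algebra.smul_def (A := T) X s
  rw [h2, map_mul] at h1
  have h3 : ev (X ⊗ₜ[K] (1 : S)) = 0 := by simp [ev]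
  have h4 : ev ((1 : K[X]) ⊗ₜ[K] f) = f := by simp [ev]
  rw [h3, h4, zero_mul] at h1
  exact h1.symm

theorem eq_zero_or_one_of_isIdempotentElem {R : Type*} [CommRing R]
    [ConnectedSpace (PrimeSpectrum R)] {e : R} (he : IsIdempotentElem e) : e = 0 ∨ e = 1 := by
  have hcl : IsClopen (PrimeSpectrum.basicOpen e : Set (PrimeSpectrum R)) :=
    PrimeSpectrum.isClopen_iff.mpr ⟨e, he, rfl⟩
  rcases isClopen_iff.mp hcl with h | h
  · left
    have h0 : IsNilpotent e := (PrimeSpectrum.basicOpen_eq_bot_iff e).mp (by ext1; simpa using h)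
    obtain ⟨n, hn⟩ := h0
    have : e ^ (n + 1) = e := he.pow_succ_eq n
    rw [← this, pow_succ, hn, zero_mul]
  · right
    have h0 : IsUnit e := by
      by_contra hu
      obtain ⟨m, hm, hem⟩ := exists_max_ideal_of_mem_nonunits hu
      have : (⟨m, hm.isPrime⟩ : PrimeSpectrum R) ∈
        (PrimeSpectrum.basicOpen e : Set (PrimeSpectrum R)) := h ▸ Set.mem_univ _
      exact this hem
    exact (IsIdempotentElem.iff_eq_one_of_isUnit h0).mp he

/-- An element of a reduced algebra of finite type over an algebraically closed field vanishes as
soon as it vanishes at all rational points. -/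
theorem eq_zero_of_forall_algHom {K D : Type*} [Field K] [IsAlgClosed K] [CommRing D]
    [Algebra K D] [Algebra.FiniteType K D] [IsReduced D] {y : D}
    (hy : ∀ ψ : D →ₐ[K] K, ψ y = 0) : y = 0 := by
  -- Nullstellensatz: the zero ideal is an intersection of maximal ideals, each with residue field
  -- `K`.
  have : IsJacobsonRing D := isJacobsonRing_of_finiteType (A := K)
  rw [← Ideal.mem_bot, ← IsJacobsonRing.out ‹IsJacobsonRing D› Ideal.isRadical_bot, Ideal.jacobson, Ideal.mem_sInf]
  rintro m ⟨-, hm⟩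
  have : m.IsMaximal := hm
  let _ := Ideal.Quotient.field m
  have : Module.Finite K (D ⧸ m) := finite_of_finite_type_of_isJacobsonRing K (D ⧸ m)
  have hb : Function.Bijective (algebraMap K (D ⧸ m)) :=
    IsAlgClosed.algebraMap_bijective_of_isIntegral
  let e : K ≃ₐ[K] (D ⧸ m) := AlgEquiv.ofBijective (Algebra.ofId K (D ⧸ m)) hb
  have := hy ((e.symm : (D ⧸ m) →ₐ[K] K).comp (Ideal.Quotient.mkₐ K m))
  simpa [Ideal.Quotient.eq_zero_iff_mem] using this

/-! ### Compatibilities with base change -/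

section TensorMul

variable {k : Type u} [Field k] {A : Type v} [NonAssocRing A] [Module k A]
  {R S : Type u} [CommRing R] [Algebra k R] [CommRing S] [Algebra k S]

theorem rTensor_one (φ : R →ₐ[k] S) : φ.toLinearMap.rTensor A (1 : R ⊗[k] A) = 1 := by
  simp [Algebra.TensorProduct.one_def]

theorem rTensor_mem_baseChange (φ : R →ₐ[k] S) (W : Submodule k A) {x : R ⊗[k] A}
    (hx : x ∈ W.baseChange R) : φ.toLinearMap.rTensor A x ∈ W.baseChange S := by
  obtain ⟨y, rfl⟩ := hx
  induction y using TensorProduct.induction_on with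
  | zero => simp
  | add y z hy hz => simp only [map_add]; exact add_mem hy hz
  | tmul r w => simpa using Submodule.tmul_mem_baseChange_of_mem (φ r) w.2

theorem map_mem_of_mem_baseChange {f : (R ⊗[k] A) →ₗ[R] (R ⊗[k] A)} {W : Submodule k A}
    {V : Submodule R (R ⊗[k] A)} (h : ∀ w ∈ W, f (1 ⊗ₜ w) ∈ V) {x : R ⊗[k] A}
    (hx : x ∈ W.baseChange R) : f x ∈ V := by
  rw [Submodule.baseChange_eq_span] at hx
  induction hx using Submodule.span_induction with
  | mem x hx =>
    obtain ⟨w, hw, rfl⟩ := hx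
    exact h w hw
  | zero => simp
  | add x y _ _ hx hy => simpa using add_mem hx hy
  | smul r x _ hx => simpa using V.smul_mem r hx

theorem det_mapEnd [FiniteDimensional k A] (φ : R →ₐ[k] S) (f : (R ⊗[k] A) →ₗ[R] (R ⊗[k] A)) :
    LinearMap.det (mapEnd φ f) = φ (LinearMap.det f) := by
  let b := Module.finBasis k A
  have hrepr : ∀ (x : R ⊗[k] A) i, (Algebra.TensorProduct.basis S b).repr
      (φ.toLinearMap.rTensor A x) i = φ ((Algebra.TensorProduct.basis R b).repr x i) := by
    intro x i
    induction x using TensorProduct.induction_on with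
    | zero => simp
    | add x y hx hy => simp only [map_add, Finsupp.add_apply, hx, hy]
    | tmul r a => simp [Algebra.TensorProduct.basis_repr_tmul]
  rw [← LinearMap.det_toMatrix (Algebra.TensorProduct.basis S b),
    ← LinearMap.det_toMatrix (Algebra.TensorProduct.basis R b), AlgHom.map_det]
  congr 1
  ext i j
  simp [LinearMap.toMatrix_apply, mapEnd_tmul, hrepr]

variable [IsScalarTower k A A] [SMulCommClass k A A]

theorem rTensor_mul (φ : R →ₐ[k] S) (x y : R ⊗[k] A) :
    φ.toLinearMap.rTensor A (x * y) = φ.toLinearMap.rTensor A x * φ.toLinearMap.rTensor A y := by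
  induction x using TensorProduct.induction_on with
  | zero => simp
  | add x₁ x₂ h₁ h₂ => simp only [add_mul, map_add, h₁, h₂]
  | tmul r a =>
    induction y using TensorProduct.induction_on with
    | zero => simp
    | add y₁ y₂ h₁ h₂ => simp only [mul_add, map_add, h₁, h₂]
    | tmul s b => simp

theorem mulLeft_baseChange (a : A) (x : R ⊗[k] A) :
    (LinearMap.mulLeft k a).baseChange R x = ((1 : R) ⊗ₜ[k] a) * x := by
  induction x using TensorProduct.induction_on with
  | zero => simp
  | add x y hx hy => simp only [map_add, mul_add, hx, hy]
  | tmul r b => simp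

theorem mulRight_baseChange (a : A) (x : R ⊗[k] A) :
    (LinearMap.mulRight k a).baseChange R x = x * ((1 : R) ⊗ₜ[k] a) := by
  induction x using TensorProduct.induction_on with
  | zero => simp
  | add x y hx hy => simp only [map_add, add_mul, hx, hy]
  | tmul r b => simp

end TensorMul

/-! ### Central idempotents -/

/-- `e` is a central idempotent of the unital non-associative ring `B`. -/
structure IsCentralIdempotent {B : Type*} [NonAssocRing B] (e : B) : Prop where
  mul_self : e * e = e
  mul_left_comm : ∀ a x, e * (a * x) = a * (e * x)
  mul_assoc : ∀ a x, (e * a) * x = e * (a * x)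

namespace IsCentralIdempotent

variable {B : Type*} [NonAssocRing B] {e f : B}

theorem comm (he : IsCentralIdempotent e) (a : B) : e * a = a * e := by
  simpa using he.mul_left_comm a 1

theorem mul_mul_self (he : IsCentralIdempotent e) (a : B) : e * (e * a) = e * a := by
  rw [he.comm a, he.mul_left_comm, he.mul_self]

theorem one_sub (he : IsCentralIdempotent e) : IsCentralIdempotent (1 - e) where
  mul_self := by simp [mul_sub, sub_mul, he.mul_self]
  mul_left_comm a x := by simp [mul_sub, sub_mul, he.mul_left_comm]
  mul_assoc a x := by simp [sub_mul, he.mul_assoc]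

theorem mul (he : IsCentralIdempotent e) (hf : IsCentralIdempotent f) :
    IsCentralIdempotent (e * f) where
  mul_self := by rw [he.mul_assoc, hf.mul_left_comm, he.mul_mul_self, hf.mul_self]
  mul_left_comm a x := by
    rw [he.mul_assoc, hf.mul_left_comm, he.mul_left_comm, he.mul_assoc]
  mul_assoc a x := by
    rw [he.mul_assoc, he.mul_assoc, he.mul_assoc, hf.mul_assoc]

theorem map {B' F : Type*} [NonAssocRing B'] [EquivLike F B B'] (g : F)
    (hg : ∀ x y, g (x * y) = g x * g y) (he : IsCentralIdempotent e) :
    IsCentralIdempotent (g e) where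
  mul_self := by rw [← hg, he.mul_self]
  mul_left_comm a x := by
    obtain ⟨a, rfl⟩ := EquivLike.surjective g a
    obtain ⟨x, rfl⟩ := EquivLike.surjective g x
    simp only [← hg, he.mul_left_comm]
  mul_assoc a x := by
    obtain ⟨a, rfl⟩ := EquivLike.surjective g a
    obtain ⟨x, rfl⟩ := EquivLike.surjective g x
    simp only [← hg, he.mul_assoc]

section BaseChange

variable {k : Type u} [Field k] {A : Type v} [NonAssocRing A] [Module k A]
  [IsScalarTower k A A] [SMulCommClass k A A]
  {R : Type u} [CommRing R] [Algebra k R]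

theorem one_tmul {e : A} (he : IsCentralIdempotent e) :
    IsCentralIdempotent ((1 : R) ⊗ₜ[k] e) where
  mul_self := by simp [he.mul_self]
  mul_left_comm a x := by
    induction a using TensorProduct.induction_on with
    | zero => simp
    | add a₁ a₂ h₁ h₂ => simp only [add_mul, mul_add, h₁, h₂]
    | tmul r a =>
      induction x using TensorProduct.induction_on with
      | zero => simp
      | add y₁ y₂ h₁ h₂ => simp only [mul_add, h₁, h₂]
      | tmul s b => simp [he.mul_left_comm]
  mul_assoc a x := by
    induction a using TensorProduct.induction_on with
    | zero => simp
    | add a₁ a₂ h₁ h₂ => simp only [add_mul, mul_add, h₁, h₂]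
    | tmul r a =>
      induction x using TensorProduct.induction_on with
      | zero => simp
      | add y₁ y₂ h₁ h₂ => simp only [mul_add, h₁, h₂]
      | tmul s b => simp [he.mul_assoc]

/-- Over a connected base, a central idempotent that vanishes at one rational point is zero. -/
theorem eq_zero_of_rTensor_eq_zero [FiniteDimensional k A] [ConnectedSpace (PrimeSpectrum R)]
    {e : R ⊗[k] A} (he : IsCentralIdempotent e) (φ : R →ₐ[k] k)
    (h : φ.toLinearMap.rTensor A e = 0) : e = 0 := by
  let f : (R ⊗[k] A) →ₗ[R] (R ⊗[k] A) := LinearMap.mulLeft R (1 - e)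
  have hf : f * f = f := LinearMap.ext fun x => he.one_sub.mul_mul_self x
  have hφ : mapEnd φ f = LinearMap.id := by
    ext a
    have : φ.toLinearMap.rTensor A (f (1 ⊗ₜ a)) = 1 ⊗ₜ a := by
      simp only [f, LinearMap.mulLeft_apply, rTensor_mul, map_sub, rTensor_one, h, sub_zero,
        one_mul]
      simp
    simpa [mapEnd_tmul] using this
  -- The determinant of an idempotent operator is idempotent, so it is `0` or `1` over a connected
  -- base; its value at `φ` is `1`. An invertible idempotent operator is the identity.
  have hdet : IsIdempotentElem (LinearMap.det f) := by
    rw [IsIdempotentElem, ← map_mul, hf]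
  have hdet1 : LinearMap.det f = 1 := by
    rcases eq_zero_or_one_of_isIdempotentElem hdet with h0 | h1
    · have := det_mapEnd φ f
      rw [hφ, h0, map_zero, LinearMap.det_id] at this
      exact absurd this one_ne_zero
    · exact h1
  have hu : IsUnit f := by
    rw [LinearMap.isUnit_iff_isUnit_det, hdet1]; exact isUnit_one
  have h1 : f = 1 := (IsIdempotentElem.iff_eq_one_of_isUnit hu).mp hf
  have := LinearMap.congr_fun h1 1
  simpa [f] using this

end BaseChange

end IsCentralIdempotent

end NonAssocAut

/-! ### Ideals stable under the group scheme -/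

/-- The submodule `W` of a non-associative algebra is a two-sided ideal. -/
structure Submodule.IsIdeal {R B : Type*} [CommRing R] [NonAssocRing B] [Module R B]
    (W : Submodule R B) : Prop where
  mul_mem_left : ∀ b, ∀ w ∈ W, b * w ∈ W
  mul_mem_right : ∀ b, ∀ w ∈ W, w * b ∈ W

namespace AutSubgroupScheme

open NonAssocAut

variable {k : Type u} [Field k] {A : Type v} [NonAssocRing A] [Module k A]
  [IsScalarTower k A A] [SMulCommClass k A A] (G : AutSubgroupScheme k A)

theorem isSubmodule_of_univ {W : Submodule k A}
    (h : ∀ w ∈ W, G.univ (1 ⊗ₜ w) ∈ W.baseChange G.coordRing) : G.IsSubmodule W := by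
  intro R _ _ g hg x hx
  obtain ⟨φ, rfl, -⟩ := G.existsUnique_map R g hg
  refine map_mem_of_mem_baseChange (f := (mapGL φ G.univ).toLinearMap) (fun w hw => ?_) hx
  have : (mapGL φ G.univ).toLinearMap (1 ⊗ₜ w) =
      φ.toLinearMap.rTensor A (G.univ (1 ⊗ₜ w)) :=
    (mapEnd_tmul φ G.univ.toLinearMap 1 w).trans (one_smul _ _)
  rw [this]
  exact rTensor_mem_baseChange φ W (h w hw)

theorem univ_mul (x y : G.coordRing ⊗[k] A) : G.univ (x * y) = G.univ x * G.univ y :=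
  G.points_le _ G.univ_mem x y

/-- This `φ` is the identity point of `G(k)`. -/
theorem exists_counit : ∃ φ : G.coordRing →ₐ[k] k, ∀ x,
    φ.toLinearMap.rTensor A (G.univ x) = φ.toLinearMap.rTensor A x := by
  obtain ⟨φ, hφ, -⟩ := G.existsUnique_map k 1 (one_mem _)
  refine ⟨φ, fun x => ?_⟩
  have h1 := mapEnd_rTensor φ G.univ.toLinearMap x
  have h2 : mapEnd φ G.univ.toLinearMap (φ.toLinearMap.rTensor A x) =
      φ.toLinearMap.rTensor A x := LinearEquiv.congr_fun hφ _
  rw [← h2, h1]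
  rfl

/-- With `g` the universal point, `g(p)(1 - p)` is a central idempotent vanishing at the identity of
`G`, hence zero. Thus `g(p) = g(p)p`, and the same for `1 - p` gives `p = g(p)p`. -/
theorem univ_one_tmul_of_isCentralIdempotent [FiniteDimensional k A] (hG : G.IsConnected) {p : A}
    (hp : IsCentralIdempotent p) : G.univ (1 ⊗ₜ p) = 1 ⊗ₜ p := by
  have : ConnectedSpace (PrimeSpectrum G.coordRing) := hG
  obtain ⟨φ, hφ⟩ := G.exists_counit
  have key : ∀ {p : A}, IsCentralIdempotent p →
      G.univ (1 ⊗ₜ p) = G.univ (1 ⊗ₜ p) * (1 ⊗ₜ p) := by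
    intro p hp
    have hp1 : IsCentralIdempotent ((1 : G.coordRing) ⊗ₜ[k] p) := hp.one_tmul
    have h := (hp1.map G.univ G.univ_mul).mul hp1.one_sub
    have h0 := h.eq_zero_of_rTensor_eq_zero φ (by
      rw [rTensor_mul, hφ, ← rTensor_mul, mul_sub, mul_one, hp1.mul_self, sub_self, map_zero])
    rwa [mul_sub, mul_one, sub_eq_zero] at h0
  have huniv : G.univ (1 : G.coordRing ⊗[k] A) = 1 := by
    obtain ⟨y, hy⟩ := G.univ.surjective 1
    have := G.univ_mul 1 y
    rw [one_mul, hy, mul_one] at this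
    exact this.symm
  have h1 := key hp
  have h2 := key hp.one_sub
  rw [TensorProduct.tmul_sub, map_sub, ← Algebra.TensorProduct.one_def, huniv, mul_sub, mul_one,
    sub_mul, one_mul, ← h1] at h2
  simpa using h2

/-- The component `p` of `1` in `I` acts as the identity on `I` and as zero on `J`, so it is a
central idempotent. It is fixed by `G`, so `g(w) = g(pw) = p g(w)` for `w` in `I`. -/
theorem isSubmodule_of_isCompl [FiniteDimensional k A] (hG : G.IsConnected) {I J : Submodule k A}
    (hI : I.IsIdeal) (hJ : J.IsIdeal) (h : IsCompl I J) : G.IsSubmodule I := by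
  have hIJ : ∀ {x}, x ∈ I → x ∈ J → x = 0 := fun hx hy =>
    (Submodule.mem_bot k).mp (h.inf_eq_bot ▸ Submodule.mem_inf.mpr ⟨hx, hy⟩)
  have hsum : ∀ x : A, ∃ y ∈ I, ∃ z ∈ J, y + z = x := fun x =>
    Submodule.mem_sup.mp (h.sup_eq_top ▸ Submodule.mem_top)
  obtain ⟨p, hp, q, hq, hpq⟩ := hsum 1
  have hpI : ∀ x ∈ I, p * x = x := fun x hx => by
    have : q * x = 0 := hIJ (hI.mul_mem_left _ _ hx) (hJ.mul_mem_right _ _ hq)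
    rw [← add_zero (p * x), ← this, ← add_mul, hpq, one_mul]
  have hpJ : ∀ x ∈ J, p * x = 0 := fun x hx =>
    hIJ (hI.mul_mem_right _ _ hp) (hJ.mul_mem_left _ _ hx)
  have hc : IsCentralIdempotent p := by
    refine ⟨hpI p hp, fun a x => ?_, fun a x => ?_⟩
    · obtain ⟨y, hy, z, hz, rfl⟩ := hsum x
      simp [mul_add, hpI y hy, hpJ z hz, hpI _ (hI.mul_mem_left a y hy),
        hpJ _ (hJ.mul_mem_left a z hz)]
    · obtain ⟨y, hy, z, hz, rfl⟩ := hsum a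
      simp [mul_add, add_mul, hpI y hy, hpJ z hz, hpI _ (hI.mul_mem_right x y hy),
        hpJ _ (hJ.mul_mem_right x z hz)]
  refine G.isSubmodule_of_univ fun w hw => ?_
  have hw' : (1 : G.coordRing) ⊗ₜ[k] w = (1 ⊗ₜ p) * (1 ⊗ₜ w) := by simp [hpI w hw]
  rw [hw', G.univ_mul, G.univ_one_tmul_of_isCentralIdempotent hG hc]
  induction G.univ ((1 : G.coordRing) ⊗ₜ[k] w) using TensorProduct.induction_on with
  | zero => simp
  | add x y hx hy => rw [mul_add]; exact add_mem hx hy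
  | tmul r a =>
    simpa using Submodule.tmul_mem_baseChange_of_mem r (hI.mul_mem_right a p hp)

/-- A proper ideal that is a `G`-submodule vanishes. -/
theorem ideal_eq_bot [FiniteDimensional k A] {ε : A →ₗ[k] k} (hε : ε 1 = 1)
    (hG_stab : G.Stabilizes ε) (h_factor : ¬ G.HasTrivialCompositionFactor (LinearMap.ker ε))
    (h_nondeg : (counitForm ε).Nondegenerate) {W : Submodule k A} (hW : W.IsIdeal)
    (hGW : G.IsSubmodule W) (htop : W ≠ ⊤) : W = ⊥ := by
  by_cases hεW : ∀ w ∈ W, ε w = 0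
  · rw [eq_bot_iff]
    intro w hw
    exact h_nondeg.1 w fun b => hεW _ (hW.mul_mem_right b w hw)
  exfalso
  push Not at hεW
  obtain ⟨a, ha, hεa⟩ : ∃ a ∈ W, ε a = 1 := by
    obtain ⟨w, hw, h⟩ := hεW
    exact ⟨(ε w)⁻¹ • w, W.smul_mem _ hw, by simp [h]⟩
  have h1W : (1 : A) ∉ W := fun h =>
    htop (eq_top_iff.mpr fun x _ => by simpa using hW.mul_mem_left x 1 h)
  let W₂ := W ⊓ LinearMap.ker ε
  let d : A := 1 - a
  have hεd : ε d = 0 := by simp [d, hε, hεa]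
  have hd : d ∉ W₂ := fun h => h1W (by simpa [d] using add_mem h.1 ha)
  -- Subtracting `ε(x) a` projects `W` onto `W₂`; this works over every `R` and identifies the
  -- kernel of `ε` on `R ⊗ W` with `R ⊗ W₂`.
  have mem_W₂ : ∀ (R : Type u) [CommRing R] [Algebra k R] (x : R ⊗[k] A), x ∈ W.baseChange R →
      x - (TensorProduct.rid k R (ε.lTensor R x)) ⊗ₜ a ∈ W₂.baseChange R := by
    intro R _ _ x hx
    obtain ⟨y, rfl⟩ := hx
    induction y using TensorProduct.induction_on with
    | zero => simp
    | add y z hy hz =>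
      simp only [map_add, TensorProduct.add_tmul]
      rw [add_sub_add_comm]
      exact add_mem hy hz
    | tmul r w =>
      have : (w : A) - ε w • a ∈ W₂ :=
        ⟨sub_mem w.2 (W.smul_mem _ ha), by simp [hεa]⟩
      have h := Submodule.tmul_mem_baseChange_of_mem r this
      rw [TensorProduct.tmul_sub, ← TensorProduct.smul_tmul] at h
      simpa using h
  have mem_W₂' : ∀ (R : Type u) [CommRing R] [Algebra k R] (x : R ⊗[k] A), x ∈ W.baseChange R →
      ε.baseChange R x = 0 → x ∈ W₂.baseChange R := by
    intro R _ _ x hx h0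
    have h := mem_W₂ R x hx
    rw [← LinearMap.baseChange_eq_ltensor, h0] at h
    simpa using h
  have hεbc : ∀ (R : Type u) [CommRing R] [Algebra k R] (x : R ⊗[k] A),
      x ∈ W₂.baseChange R → ε.baseChange R x = 0 := by
    intro R _ _ x hx
    have := map_mem_of_mem_baseChange (R := R) (f := LinearMap.id)
      (V := LinearMap.ker (ε.baseChange R)) (W := W₂) (fun w hw => by
        have : ε w = 0 := hw.2
        simp [this]) hx
    exact this
  have hle : ∀ (R : Type u) [CommRing R] [Algebra k R], W₂.baseChange R ≤ W.baseChange R :=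
    fun R _ _ => Submodule.baseChange_mono R inf_le_left
  have hG₂ : G.IsSubmodule W₂ := by
    intro R _ _ g hg x hx
    refine mem_W₂' R _ (hGW R g hg x (hle R hx)) ?_
    rw [hG_stab R g hg, hεbc R x hx]
  have hgd : ∀ (R : Type u) [CommRing R] [Algebra k R], ∀ g ∈ G.points R,
      g (1 ⊗ₜ d) - 1 ⊗ₜ d ∈ W₂.baseChange R := by
    intro R _ _ g hg
    have hg1 : g (1 : R ⊗[k] A) = 1 := by
      obtain ⟨y, hy⟩ := g.surjective 1
      have := G.points_le R hg 1 y
      rw [one_mul, hy, mul_one] at this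
      exact this.symm
    have haW := Submodule.tmul_mem_baseChange_of_mem (1 : R) ha
    -- Since `g` fixes `1`, moving `d` is the same as moving `a` inside the stable ideal `W`.
    have : g (1 ⊗ₜ d) - 1 ⊗ₜ d = (1 : R) ⊗ₜ[k] a - g (1 ⊗ₜ a) := by
      simp only [d, TensorProduct.tmul_sub, map_sub, ← Algebra.TensorProduct.one_def, hg1]
      abel
    rw [this]
    refine mem_W₂' R _ (sub_mem haW (hGW R g hg _ haW)) ?_
    rw [map_sub, hG_stab R g hg, sub_self]
  let W₁ := W₂ ⊔ k ∙ d
  have hdiff : ∀ (R : Type u) [CommRing R] [Algebra k R], ∀ g ∈ G.points R,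
      ∀ x ∈ W₁.baseChange R, g x - x ∈ W₂.baseChange R := by
    intro R _ _ g hg x hx
    refine map_mem_of_mem_baseChange (f := g.toLinearMap - LinearMap.id) (fun w hw => ?_) hx
    obtain ⟨v, hv, _, hc, rfl⟩ := Submodule.mem_sup.mp hw
    obtain ⟨c, rfl⟩ := Submodule.mem_span_singleton.mp hc
    have hv' := Submodule.tmul_mem_baseChange_of_mem (1 : R) hv
    have e : (g.toLinearMap - LinearMap.id : R ⊗[k] A →ₗ[R] R ⊗[k] A) (1 ⊗ₜ (v + c • d)) =
        (g (1 ⊗ₜ v) - 1 ⊗ₜ v) + algebraMap k R c • (g (1 ⊗ₜ d) - 1 ⊗ₜ d) := by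
      have : (1 : R) ⊗ₜ[k] (c • d) = algebraMap k R c • ((1 : R) ⊗ₜ[k] d) := by
        rw [← TensorProduct.smul_tmul, TensorProduct.smul_tmul', Algebra.algebraMap_eq_smul_one,
          smul_eq_mul, mul_one]
      simp only [TensorProduct.tmul_add, map_add, LinearMap.sub_apply, LinearEquiv.coe_coe,
        LinearMap.id_apply, this, map_smul, smul_sub]
    rw [e]
    exact add_mem (sub_mem (hG₂ R g hg _ hv') hv') (Submodule.smul_mem _ _ (hgd R g hg))
  refine h_factor ⟨W₁, W₂, ?_, hG₂, le_sup_left, ?_, ?_, hdiff⟩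
  · intro R _ _ g hg x hx
    have h := Submodule.baseChange_mono R (le_sup_left : W₂ ≤ W₁) (hdiff R g hg x hx)
    simpa using add_mem h hx
  · refine sup_le inf_le_right ?_
    rw [Submodule.span_singleton_le_iff_mem]
    exact hεd
  · let dW : W₁ ⧸ W₂.submoduleOf W₁ := Submodule.Quotient.mk
      ⟨d, le_sup_right (α := Submodule k A) (Submodule.mem_span_singleton_self d)⟩
    refine finrank_eq_one_iff'.mpr ⟨dW, ?_, ?_⟩
    · rw [Ne, Submodule.Quotient.mk_eq_zero]
      exact hd
    · intro x
      obtain ⟨⟨x, hx⟩, rfl⟩ := Submodule.Quotient.mk_surjective _ x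
      obtain ⟨w, hw, _, hc, rfl⟩ := Submodule.mem_sup.mp hx
      obtain ⟨c, rfl⟩ := Submodule.mem_span_singleton.mp hc
      refine ⟨c, ?_⟩
      rw [← Submodule.Quotient.mk_smul, Submodule.Quotient.eq]
      simpa [Submodule.submoduleOf] using hw

end AutSubgroupScheme

/-! ### Maximal two-sided ideals -/

namespace Submodule

section

variable {R B : Type*} [CommRing R] [NonAssocRing B] [Module R B]

/-- The two-sided ideal `P` is maximal. -/
structure IsMaximalIdeal (P : Submodule R B) : Prop where
  isIdeal : P.IsIdeal
  ne_top : P ≠ ⊤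
  eq_or_eq_top : ∀ Q : Submodule R B, Q.IsIdeal → P ≤ Q → Q = P ∨ Q = ⊤

variable (R B) in
/-- The intersection of the maximal two-sided ideals. -/
def idealRadical : Submodule R B := sInf {P | P.IsMaximalIdeal}

theorem mem_idealRadical {x : B} :
    x ∈ idealRadical R B ↔ ∀ P : Submodule R B, P.IsMaximalIdeal → x ∈ P := by
  simp [idealRadical, Submodule.mem_sInf]

theorem isIdeal_idealRadical : (idealRadical R B).IsIdeal where
  mul_mem_left b w hw := mem_idealRadical.mpr fun P hP =>
    hP.isIdeal.mul_mem_left b w (mem_idealRadical.mp hw P hP)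
  mul_mem_right b w hw := mem_idealRadical.mpr fun P hP =>
    hP.isIdeal.mul_mem_right b w (mem_idealRadical.mp hw P hP)

theorem exists_isMaximalIdeal [IsNoetherian R B] [Nontrivial B] :
    ∃ P : Submodule R B, P.IsMaximalIdeal := by
  obtain ⟨P, ⟨hP, hne⟩, hmax⟩ := WellFounded.has_min
    (wellFounded_gt : WellFounded ((· > ·) : Submodule R B → Submodule R B → Prop))
    {P | P.IsIdeal ∧ P ≠ ⊤}
    ⟨⊥, ⟨fun b w hw => by simp_all, fun b w hw => by simp_all⟩, bot_ne_top⟩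
  refine ⟨P, hP, hne, fun Q hQ hPQ => ?_⟩
  by_contra! h
  exact hmax Q ⟨hQ, h.2⟩ (lt_of_le_of_ne hPQ h.1.symm)

theorem IsIdeal.comap {P : Submodule R B} (hP : P.IsIdeal) (g : B ≃ₗ[R] B)
    (hg : ∀ x y, g (x * y) = g x * g y) : (P.comap g.toLinearMap).IsIdeal where
  mul_mem_left b w hw := by simpa [hg] using hP.mul_mem_left (g b) _ hw
  mul_mem_right b w hw := by simpa [hg] using hP.mul_mem_right (g b) _ hw

theorem IsMaximalIdeal.comap {P : Submodule R B} (hP : P.IsMaximalIdeal) (g : B ≃ₗ[R] B)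
    (hg : ∀ x y, g (x * y) = g x * g y) : (P.comap g.toLinearMap).IsMaximalIdeal where
  isIdeal := hP.isIdeal.comap g hg
  ne_top h := hP.ne_top <| eq_top_iff.mpr fun x _ => by
    have : g.symm x ∈ P.comap g.toLinearMap := h ▸ mem_top
    simpa using this
  eq_or_eq_top Q hQ hle := by
    have hg' : ∀ x y, g.symm (x * y) = g.symm x * g.symm y := fun x y => by
      apply g.injective; simp [hg]
    have hQ' : Q = (Q.comap g.symm.toLinearMap).comap g.toLinearMap := by ext; simp
    refine (hP.eq_or_eq_top _ (hQ.comap g.symm hg') fun x hx => hle (by simpa using hx)).imp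
      (fun h => by rw [hQ', h]) (fun h => by rw [hQ', h]; rfl)

theorem map_mem_idealRadical (g : B ≃ₗ[R] B) (hg : ∀ x y, g (x * y) = g x * g y) {x : B}
    (hx : x ∈ idealRadical R B) : g x ∈ idealRadical R B :=
  mem_idealRadical.mpr fun _ hP => mem_idealRadical.mp hx _ (hP.comap g hg)

end

end Submodule

/-! ### The multiplication algebra and its nilpotent ideals -/

namespace NonAssocAut

/-- Nakayama-type descent along a nilpotent left ideal. -/
theorem mem_of_isNilpotent {M β : Type*} [Ring M] {N : Ideal M} (hN : IsNilpotent N)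
    (act : M → β → β) (act_one : ∀ y, act 1 y = y)
    (act_mul : ∀ m n y, act (m * n) y = act m (act n y)) {p : Set β} (h0 : ∀ y, act 0 y ∈ p)
    (hp : ∀ y, (∀ n ∈ N, act n y ∈ p) → y ∈ p) (y : β) : y ∈ p := by
  have key : ∀ (j : ℕ) (y : β), (∀ n ∈ N ^ j, act n y ∈ p) → y ∈ p := by
    intro j
    induction j with
    | zero =>
      intro y hy
      have := hy 1 (by simp [Submodule.pow_zero, Ideal.one_eq_top])
      rwa [act_one] at this
    | succ j ih =>
      -- If `N ^ (j + 1)` sends `y` into `p`, then `N ^ j` sends each `n y` into `p`, so `N` sends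
      -- `y` into `p`.
      refine fun y hy => hp y fun n hn => ih _ fun n' hn' => ?_
      have := hy (n' * n) (by rw [Submodule.pow_succ]; exact Submodule.smul_mem_smul hn' hn)
      rwa [act_mul] at this
  obtain ⟨j, hj⟩ := hN
  refine key j y fun n hn => ?_
  rw [hj] at hn
  rw [show n = 0 from hn]
  exact h0 y

section MultiplicationAlgebra

variable (k : Type u) [Field k] (A : Type v) [NonAssocRing A] [Module k A]
  [IsScalarTower k A A] [SMulCommClass k A A]

/-- The associative algebra of endomorphisms of `A` generated by the left and right
multiplications. -/
abbrev multiplicationAlgebra : Subalgebra k (Module.End k A) :=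
  Algebra.adjoin k (Set.range (LinearMap.mulLeft k (A := A)) ∪ Set.range (LinearMap.mulRight k))

variable {k A}

theorem mulLeft_mem_multiplicationAlgebra (a : A) :
    LinearMap.mulLeft k a ∈ multiplicationAlgebra k A :=
  Algebra.subset_adjoin (Or.inl ⟨a, rfl⟩)

theorem mulRight_mem_multiplicationAlgebra (a : A) :
    LinearMap.mulRight k a ∈ multiplicationAlgebra k A :=
  Algebra.subset_adjoin (Or.inr ⟨a, rfl⟩)

theorem baseChange_mem_of_isIdeal {K : Type u} [CommRing K] [Algebra k K]
    {P : Submodule K (K ⊗[k] A)} (hP : P.IsIdeal) {m : Module.End k A}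
    (hm : m ∈ multiplicationAlgebra k A) : ∀ y ∈ P, m.baseChange K y ∈ P := by
  induction hm using Algebra.adjoin_induction with
  | mem m hm =>
    rintro y hy
    rcases hm with ⟨a, rfl⟩ | ⟨a, rfl⟩
    · rw [mulLeft_baseChange]; exact hP.mul_mem_left _ _ hy
    · rw [mulRight_baseChange]; exact hP.mul_mem_right _ _ hy
  | algebraMap c =>
    intro y hy
    have : ∀ y, (algebraMap k (Module.End k A) c).baseChange K y = algebraMap k K c • y := by
      intro y
      induction y using TensorProduct.induction_on with
      | zero => simp
      | add x y hx hy => simp only [map_add, smul_add, hx, hy]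
      | tmul r a => simp [TensorProduct.tmul_smul]
    rw [this]
    exact P.smul_mem _ hy
  | add m n _ _ hm hn =>
    intro y hy
    rw [LinearMap.baseChange_add]
    exact add_mem (hm y hy) (hn y hy)
  | mul m n _ _ hm hn =>
    intro y hy
    rw [LinearMap.baseChange_mul]
    exact hm _ (hn y hy)

/-- The operators in a nilpotent ideal of the multiplication algebra map every base change
of `A` into each maximal ideal. -/
theorem baseChange_mem_of_isMaximalIdeal {K : Type u} [CommRing K] [Algebra k K]
    {P : Submodule K (K ⊗[k] A)} (hP : P.IsMaximalIdeal)
    (N : Ideal (multiplicationAlgebra k A)) [N.IsTwoSided] (hN : IsNilpotent N)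
    {n : multiplicationAlgebra k A} (hn : n ∈ N) (y : K ⊗[k] A) :
    (n : Module.End k A).baseChange K y ∈ P := by
  -- `Q` consists of the elements sent into `P` by all of `N`. It is an ideal containing `P`, so it
  -- is `P` or everything; `Q = P` would force `P = ⊤` by nilpotency.
  let Q : Submodule K (K ⊗[k] A) := ⨅ n ∈ N, P.comap ((n : Module.End k A).baseChange K)
  have hQ : ∀ {y}, y ∈ Q ↔ ∀ n ∈ N, (n : Module.End k A).baseChange K y ∈ P := by
    simp [Q, Submodule.mem_iInf]
  have hmul : ∀ (m : multiplicationAlgebra k A) (y), y ∈ Q →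
      (m : Module.End k A).baseChange K y ∈ Q := by
    intro m y hy
    refine hQ.mpr fun n hn => ?_
    have := hQ.mp hy (n * m) (N.mul_mem_right m hn)
    simpa [LinearMap.baseChange_mul] using this
  have hQI : Q.IsIdeal := by
    constructor
    · intro b w hw
      induction b using TensorProduct.induction_on with
      | zero => simp
      | add x y hx hy => rw [add_mul]; exact add_mem hx hy
      | tmul c a =>
        have : c ⊗ₜ[k] a = c • ((1 : K) ⊗ₜ[k] a) := by simp [TensorProduct.smul_tmul']
        rw [this, smul_mul_assoc, ← mulLeft_baseChange]
        exact Q.smul_mem _ (hmul ⟨_, mulLeft_mem_multiplicationAlgebra a⟩ w hw)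
    · intro b w hw
      induction b using TensorProduct.induction_on with
      | zero => simp
      | add x y hx hy => rw [mul_add]; exact add_mem hx hy
      | tmul c a =>
        have : c ⊗ₜ[k] a = c • ((1 : K) ⊗ₜ[k] a) := by simp [TensorProduct.smul_tmul']
        rw [this, mul_smul_comm, ← mulRight_baseChange]
        exact Q.smul_mem _ (hmul ⟨_, mulRight_mem_multiplicationAlgebra a⟩ w hw)
  rcases hP.eq_or_eq_top Q hQI fun y hy => hQ.mpr fun n _ =>
    baseChange_mem_of_isIdeal hP.isIdeal n.2 y hy with h | h
  · exfalso
    refine hP.ne_top (eq_top_iff.mpr fun y _ => mem_of_isNilpotent hN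
      (fun m => (m : Module.End k A).baseChange K) (p := P) (fun y => ?_) (fun m n y => ?_)
      (fun y => ?_) (fun y hy => ?_) y)
    · simp [LinearMap.baseChange_one]
    · simp [LinearMap.baseChange_mul]
    · simp
    · rw [SetLike.mem_coe, ← h]
      exact hQ.mpr hy
  · exact hQ.mp (h ▸ Submodule.mem_top) n hn

/-- A subspace of `A` stable under the multiplication algebra is an ideal. -/
theorem isIdeal_restrictScalars (W : Submodule (multiplicationAlgebra k A) A) :
    (W.restrictScalars k).IsIdeal where
  mul_mem_left b _ hw := W.smul_mem ⟨_, mulLeft_mem_multiplicationAlgebra b⟩ hw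
  mul_mem_right b _ hw := W.smul_mem ⟨_, mulRight_mem_multiplicationAlgebra b⟩ hw

end MultiplicationAlgebra

end NonAssocAut

/-! ### Stability of the geometric radical -/

namespace AutSubgroupScheme

open NonAssocAut

variable {k : Type u} [Field k] {A : Type v} [NonAssocRing A] [Module k A]
  [IsScalarTower k A A] [SMulCommClass k A A] (G : AutSubgroupScheme k A)

/-- The trace on `A` of the radical of the base change of `A` to the algebraic closure. -/
noncomputable def geometricRadical (k : Type u) [Field k] (A : Type v) [NonAssocRing A]
    [Module k A] [IsScalarTower k A A] [SMulCommClass k A A] : Submodule k A :=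
  ((Submodule.idealRadical (AlgebraicClosure k) (AlgebraicClosure k ⊗[k] A)).restrictScalars k).comap
    (TensorProduct.mk k (AlgebraicClosure k) A 1)

theorem isIdeal_geometricRadical : (geometricRadical k A).IsIdeal where
  mul_mem_left b w hw := by
    have := Submodule.isIdeal_idealRadical.mul_mem_left ((1 : AlgebraicClosure k) ⊗ₜ[k] b) _ hw
    simpa using! this
  mul_mem_right b w hw := by
    have := Submodule.isIdeal_idealRadical.mul_mem_right ((1 : AlgebraicClosure k) ⊗ₜ[k] b) _ hw
    simpa using! this

theorem geometricRadical_ne_top [FiniteDimensional k A] [Nontrivial A] :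
    geometricRadical k A ≠ ⊤ := by
  intro h
  obtain ⟨P, hP⟩ := Submodule.exists_isMaximalIdeal
    (R := AlgebraicClosure k) (B := AlgebraicClosure k ⊗[k] A)
  have h1 : (1 : A) ∈ geometricRadical k A := h ▸ Submodule.mem_top
  have h2 : (1 : AlgebraicClosure k ⊗[k] A) ∈ P := Submodule.mem_idealRadical.mp h1 P hP
  exact hP.ne_top (eq_top_iff.mpr fun x _ => by simpa using hP.isIdeal.mul_mem_left x 1 h2)

/-- Automorphisms of `K ⊗ A` permute its maximal ideals, so stability holds at every `K`-point of
`G`. These points detect functions because `K ⊗ k[G]` is reduced and of finite type over `K`. -/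
theorem isSubmodule_geometricRadical [FiniteDimensional k A] (hG : G.IsSmooth) :
    G.IsSubmodule (geometricRadical k A) := by
  let K := AlgebraicClosure k
  let J := Submodule.idealRadical K (K ⊗[k] A)
  let C := G.coordRing
  let q : A →ₗ[k] ((K ⊗[k] A) ⧸ J) := J.mkQ.restrictScalars k ∘ₗ TensorProduct.mk k K A 1
  have : Algebra.Smooth k C := hG
  have : IsReduced (K ⊗[k] C) := isReduced_of_smooth K (K ⊗[k] C)
  have hq : geometricRadical k A = LinearMap.ker q := by
    ext a
    simp [geometricRadical, q, J, K]
  refine G.isSubmodule_of_univ fun a ha => ?_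
  rw [hq]
  -- By flatness, the kernel of `C ⊗ q` is the base change of `ker q`.
  suffices h : q.lTensor C (G.univ (1 ⊗ₜ a)) = 0 by
    have h' := (Module.Flat.ker_lTensor_eq (R := k) C C q).le (x := G.univ (1 ⊗ₜ a)) h
    exact h'
  have hpt : ∀ (φ : C →ₐ[k] K), J.mkQ (φ.toLinearMap.rTensor A (G.univ (1 ⊗ₜ a))) = 0 := by
    intro φ
    have h1 := G.map_mem φ G.univ G.univ_mem
    have h2 : mapGL φ G.univ (1 ⊗ₜ a) ∈ J :=
      Submodule.map_mem_idealRadical _ (G.points_le _ h1) ha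
    have h3 : mapGL φ G.univ (1 ⊗ₜ a) = φ.toLinearMap.rTensor A (G.univ (1 ⊗ₜ a)) :=
      (mapEnd_tmul φ G.univ.toLinearMap 1 a).trans (one_smul _ _)
    rw [← h3]
    exact (Submodule.Quotient.mk_eq_zero J).mpr h2
  -- Each coordinate is an element of `K ⊗ C`; a `K`-algebra map `K ⊗ C → K` evaluates it at a
  -- `K`-point `φ` of `G`, where it vanishes.
  have hfun : ∀ (l : ((K ⊗[k] A) ⧸ J) →ₗ[K] K),
      (l.restrictScalars k).lTensor C (q.lTensor C (G.univ (1 ⊗ₜ a))) = 0 := by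
    intro l
    apply (TensorProduct.comm k C K).injective
    rw [map_zero]
    refine eq_zero_of_forall_algHom (K := K) fun ψ => ?_
    let φ : C →ₐ[k] K := (ψ.restrictScalars k).comp Algebra.TensorProduct.includeRight
    have hcomp : ∀ x : C ⊗[k] A, ψ (TensorProduct.comm k C K
        ((l.restrictScalars k).lTensor C (q.lTensor C x))) =
        l (J.mkQ (φ.toLinearMap.rTensor A x)) := by
      intro x
      induction x using TensorProduct.induction_on with
      | zero => simp
      | add x y hx hy => simp only [map_add, hx, hy]
      | tmul c b =>
        have h1 : l (J.mkQ (φ c ⊗ₜ b)) = φ c * l (J.mkQ (1 ⊗ₜ b)) := by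
          rw [← smul_eq_mul, ← map_smul, ← map_smul, TensorProduct.smul_tmul', smul_eq_mul,
            mul_one]
        have h2 : ∀ κ : K, ψ (κ ⊗ₜ c) = φ c * κ := by
          intro κ
          have : κ ⊗ₜ[k] c = κ • ((1 : K) ⊗ₜ[k] c) := by simp [TensorProduct.smul_tmul']
          rw [this, map_smul, smul_eq_mul, mul_comm]
          rfl
        exact (h2 _).trans h1.symm
    rw [hcomp, hpt, map_zero]
  let b := Module.finBasis K ((K ⊗[k] A) ⧸ J)
  let e : ((K ⊗[k] A) ⧸ J) ≃ₗ[k] (Fin _ → K) := b.equivFun.restrictScalars k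
  apply (LinearEquiv.lTensor C e).injective
  apply (TensorProduct.piRight k k C (fun _ => K)).injective
  rw [map_zero, map_zero]
  ext1 i
  have hi : ∀ x : C ⊗[k] ((K ⊗[k] A) ⧸ J),
      TensorProduct.piRight k k C (fun _ => K) (LinearEquiv.lTensor C e x) i =
        ((b.coord i).restrictScalars k).lTensor C x := by
    intro x
    induction x using TensorProduct.induction_on with
    | zero => simp
    | add x y hx hy => simp only [map_add, Pi.add_apply, hx, hy]
    | tmul c y => simp [e]
  rw [hi, hfun]
  rfl

end AutSubgroupScheme

/-! ### Simplicity -/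

open NonAssocAut AutSubgroupScheme

theorem mainTheorem11 (k : Type u) [Field k] (A : Type v) [NonAssocRing A] [Module k A]
    [IsScalarTower k A A] [SMulCommClass k A A] [FiniteDimensional k A]
    (ε : A →ₗ[k] k) (hε : ε 1 = 1)
    (G : AutSubgroupScheme k A) (hG_smooth : G.IsSmooth) (hG_conn : G.IsConnected)
    (hG_stab : G.Stabilizes ε)
    (h_factor : ¬ G.HasTrivialCompositionFactor (LinearMap.ker ε))
    (h_nondeg : (counitForm ε).Nondegenerate) :
    IsSimpleRing A := by
  have : Nontrivial A := ⟨1, 0, fun h => by simp [h] at hε⟩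
  let M := multiplicationAlgebra k A
  have hrad : geometricRadical k A = ⊥ := G.ideal_eq_bot hε hG_stab h_factor h_nondeg
    isIdeal_geometricRadical (G.isSubmodule_geometricRadical hG_smooth) geometricRadical_ne_top
  have : IsArtinianRing M := .of_finite k M
  have hM : IsSemisimpleRing M := by
    rw [IsArtinianRing.isSemisimpleRing_iff_jacobson, eq_bot_iff]
    intro n hn
    rw [Submodule.mem_bot]
    ext a
    -- The Jacobson radical of an Artinian ring is nilpotent, so after base change its operators
    -- land in every maximal ideal of `K ⊗ A`.
    have h : (n : Module.End k A) a ∈ geometricRadical k A :=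
      Submodule.mem_idealRadical.mpr fun P hP => by
        simpa using baseChange_mem_of_isMaximalIdeal hP (Ring.jacobson M)
          IsSemiprimaryRing.isNilpotent hn (1 ⊗ₜ a)
    rw [hrad] at h
    simpa using h
  constructor
  refine { toNontrivial := inferInstance, eq_bot_or_eq_top := fun I => ?_ }
  have hsmul : ∀ m : M, ∀ x ∈ I, m • x ∈ I := by
    rintro ⟨m, hm⟩
    change ∀ x ∈ I, m x ∈ I
    induction hm using Algebra.adjoin_induction with
    | mem m hm =>
      rintro y hy
      rcases hm with ⟨a, rfl⟩ | ⟨a, rfl⟩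
      · exact I.mul_mem_left _ _ hy
      · exact I.mul_mem_right _ _ hy
    | algebraMap c =>
      intro y hy
      -- A two-sided ideal absorbs scalars because `c` acts as multiplication by `c • 1`.
      simpa using I.mul_mem_left (c • 1) _ hy
    | add m n _ _ hm hn => exact fun y hy => add_mem (hm y hy) (hn y hy)
    | mul m n _ _ hm hn => exact fun y hy => hm _ (hn y hy)
  let W : Submodule M A :=
    { carrier := I
      add_mem' := I.add_mem
      zero_mem' := I.zero_mem
      smul_mem' := fun m x hx => hsmul m x hx }
  -- Semisimplicity of `M` supplies a complementary `M`-submodule, which is again an ideal.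
  obtain ⟨V, hV⟩ := exists_isCompl W
  have hc : IsCompl (W.restrictScalars k) (V.restrictScalars k) := by
    refine ⟨Submodule.disjoint_def.mpr fun x hx hy => Submodule.disjoint_def.mp hV.disjoint x hx hy,
      Submodule.codisjoint_iff_exists_add_eq.mpr fun x => ?_⟩
    exact Submodule.codisjoint_iff_exists_add_eq.mp hV.codisjoint x
  have hGW := G.isSubmodule_of_isCompl hG_conn (isIdeal_restrictScalars W)
    (isIdeal_restrictScalars V) hc
  by_cases htop : W.restrictScalars k = ⊤
  · right
    ext x
    have : x ∈ W.restrictScalars k := htop ▸ Submodule.mem_top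
    exact ⟨fun _ => trivial, fun _ => this⟩
  · left
    have hbot := G.ideal_eq_bot hε hG_stab h_factor h_nondeg (isIdeal_restrictScalars W) hGW htop
    ext x
    have : x ∈ W.restrictScalars k ↔ x = 0 := by rw [hbot]; exact Submodule.mem_bot k
    exact this.trans (TwoSidedIdeal.mem_bot A).symm
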